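/- Let $G$ be a finite group and $H\le G$ a subgroup. For a finite group $K$, an $\mathbb{R}K$-module means a finite-dimensional real representation of $K$, and $\operatorname{RO}(K)$ denotes the Grothendieck group of isomorphism classes of $\mathbb{R}K$-modules under direct sum. Two $\mathbb{R}K$-modules $U,V$ are called $\mathcal{P}$-matched if $\operatorname{Res}^K_P U\cong\operatorname{Res}^K_P V$ for every subgroup $P\le K$ of prime power order, and $\operatorname{PO}(K)\le\operatorname{RO}(K)$ is the subgroup of the elements $U-V$ with $U$ and $V$ $\mathcal{P}$-matched; here $1=p^0$ counts as a prime power. For $g\in K$ let $(g)_K^{\pm}$ be the union of the conjugacy classes of $g$ and of $g^{-1}$ in $K$. Then the induction homomorphism $\operatorname{RO}(H)\to\operatorname{RO}(G)$, $U-V\mapsto \operatorname{Ind}_H^G(U)-\operatorname{Ind}_H^G(V)$, maps $\operatorname{PO}(H)$ into $\operatorname{PO}(G)$, and the resulting homomorphism $\operatorname{Ind}_H^G\colon\operatorname{PO}(H)\to\operatorname{PO}(G)$ is injective if and only if $(h)_G^{\pm}\cap H=(h)_H^{\pm}$ for every $h\in H$ whose order is not a prime power. -/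

import Mathlib

universe u

noncomputable section

open scoped MonoidAlgebra

namespace RealRepRing

/-! ### Induction of representations on morphisms and direct sums -/

section Induction

variable {K G : Type u} [Group K] [Group G] (φ : K →* G)
  {V W X : Type u} [AddCommGroup V] [Module ℝ V] [AddCommGroup W] [Module ℝ W]
  [AddCommGroup X] [Module ℝ X]
  {ρ : Representation ℝ K V} {σ : Representation ℝ K W} {τ : Representation ℝ K X}

/-- The linear map on induced spaces induced by an intertwining linear map. -/
def indVMap (f : V →ₗ[ℝ] W) (hf : ∀ k, f ∘ₗ ρ k = σ k ∘ₗ f) :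
    Representation.IndV φ ρ →ₗ[ℝ] Representation.IndV φ σ :=
  Representation.Coinvariants.map _ _ ⟨f.lTensor _, fun k => by
    ext h v
    have := LinearMap.congr_fun (hf k) v
    simp at this
    simp [this]⟩

theorem indVMap_mk (f : V →ₗ[ℝ] W) (hf : ∀ k, f ∘ₗ ρ k = σ k ∘ₗ f) (g : G) (v : V) :
    indVMap φ f hf (Representation.IndV.mk φ ρ g v) = Representation.IndV.mk φ σ g (f v) := by
  simp [indVMap]

theorem indVMap_ind (f : V →ₗ[ℝ] W) (hf : ∀ k, f ∘ₗ ρ k = σ k ∘ₗ f) (g : G) :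
    indVMap φ f hf ∘ₗ Representation.ind φ ρ g =
      Representation.ind φ σ g ∘ₗ indVMap φ f hf := by
  refine Representation.IndV.hom_ext φ ρ fun h => LinearMap.ext fun v => ?_
  change indVMap φ f hf (Representation.ind φ ρ g (Representation.IndV.mk φ ρ h v)) =
    Representation.ind φ σ g (indVMap φ f hf (Representation.IndV.mk φ ρ h v))
  rw [indVMap_mk, Representation.ind_mk, Representation.ind_mk, indVMap_mk]

/-- Isomorphic representations have isomorphic induced representations. -/
theorem ind_congr (e : ρ.Equiv σ) :
    Nonempty ((Representation.ind φ ρ).Equiv (Representation.ind φ σ)) := by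
  have h1 : ∀ k, e.toLinearEquiv.toLinearMap ∘ₗ ρ k = σ k ∘ₗ e.toLinearEquiv.toLinearMap :=
    fun k => e.isIntertwining' k
  have h2 : ∀ k, e.toLinearEquiv.symm.toLinearMap ∘ₗ σ k =
      ρ k ∘ₗ e.toLinearEquiv.symm.toLinearMap :=
    fun k => e.symm.isIntertwining' k
  refine ⟨Representation.Equiv.mk
    (LinearEquiv.ofLinearMap (indVMap φ _ h1) (indVMap φ _ h2) ?_ ?_)
    fun g => indVMap_ind φ _ h1 g⟩
  · refine Representation.IndV.hom_ext φ σ fun h => LinearMap.ext fun v => ?_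
    change indVMap φ _ h1 (indVMap φ _ h2 (Representation.IndV.mk φ σ h v)) =
      Representation.IndV.mk φ σ h v
    rw [indVMap_mk, indVMap_mk]
    exact congrArg _ (e.toLinearEquiv.apply_symm_apply v)
  · refine Representation.IndV.hom_ext φ ρ fun h => LinearMap.ext fun v => ?_
    change indVMap φ _ h2 (indVMap φ _ h1 (Representation.IndV.mk φ ρ h v)) =
      Representation.IndV.mk φ ρ h v
    rw [indVMap_mk, indVMap_mk]
    exact congrArg _ (e.toLinearEquiv.symm_apply_apply v)

variable (ρ σ) in
/-- Induction commutes with direct sums. -/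
theorem ind_prod :
    Nonempty ((Representation.ind φ (ρ.prod σ)).Equiv
      ((Representation.ind φ ρ).prod (Representation.ind φ σ))) := by
  have f1 : ∀ k, LinearMap.fst ℝ V W ∘ₗ (ρ.prod σ) k = ρ k ∘ₗ LinearMap.fst ℝ V W :=
    fun k => by ext <;> simp [Representation.prod]
  have f2 : ∀ k, LinearMap.snd ℝ V W ∘ₗ (ρ.prod σ) k = σ k ∘ₗ LinearMap.snd ℝ V W :=
    fun k => by ext <;> simp [Representation.prod]
  have i1 : ∀ k, LinearMap.inl ℝ V W ∘ₗ ρ k = (ρ.prod σ) k ∘ₗ LinearMap.inl ℝ V W :=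
    fun k => by ext <;> simp [Representation.prod]
  have i2 : ∀ k, LinearMap.inr ℝ V W ∘ₗ σ k = (ρ.prod σ) k ∘ₗ LinearMap.inr ℝ V W :=
    fun k => by ext <;> simp [Representation.prod]
  refine ⟨Representation.Equiv.mk (LinearEquiv.ofLinearMap
    ((indVMap φ _ f1).prod (indVMap φ _ f2))
    ((indVMap φ _ i1).coprod (indVMap φ _ i2)) ?_ ?_) fun g => ?_⟩
  · refine LinearMap.prod_ext ?_ ?_
    · refine Representation.IndV.hom_ext φ ρ fun h => LinearMap.ext fun v => ?_
      change ((indVMap φ _ f1).prod (indVMap φ _ f2))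
        (((indVMap φ _ i1).coprod (indVMap φ _ i2)) (Representation.IndV.mk φ ρ h v, 0)) =
          (Representation.IndV.mk φ ρ h v, 0)
      rw [LinearMap.coprod_apply, map_zero, add_zero, indVMap_mk]
      refine Prod.ext ((indVMap_mk φ _ f1 h _).trans rfl) ((indVMap_mk φ _ f2 h _).trans ?_)
      exact map_zero _
    · refine Representation.IndV.hom_ext φ σ fun h => LinearMap.ext fun v => ?_
      change ((indVMap φ _ f1).prod (indVMap φ _ f2))
        (((indVMap φ _ i1).coprod (indVMap φ _ i2)) (0, Representation.IndV.mk φ σ h v)) =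
          (0, Representation.IndV.mk φ σ h v)
      rw [LinearMap.coprod_apply, map_zero, zero_add, indVMap_mk]
      refine Prod.ext ((indVMap_mk φ _ f1 h _).trans ?_) ((indVMap_mk φ _ f2 h _).trans rfl)
      exact map_zero _
  · refine Representation.IndV.hom_ext φ (ρ.prod σ) fun h => LinearMap.ext fun v => ?_
    change indVMap φ _ i1 (indVMap φ _ f1 (Representation.IndV.mk φ _ h v)) +
      indVMap φ _ i2 (indVMap φ _ f2 (Representation.IndV.mk φ _ h v)) =
        Representation.IndV.mk φ _ h v
    rw [indVMap_mk, indVMap_mk, indVMap_mk, indVMap_mk, ← map_add]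
    exact congrArg _ (Prod.ext (add_zero v.1) (zero_add v.2))
  · refine Representation.IndV.hom_ext φ (ρ.prod σ) fun h => LinearMap.ext fun v => ?_
    have e1 := LinearMap.congr_fun (indVMap_ind φ _ f1 g) (Representation.IndV.mk φ _ h v)
    have e2 := LinearMap.congr_fun (indVMap_ind φ _ f2 g) (Representation.IndV.mk φ _ h v)
    exact Prod.ext e1 e2

end Induction

/-! ### The real representation group -/

/-- A finite-dimensional `ℝG`-module. -/
structure FinRep (G : Type u) [Group G] where
  /-- The underlying real vector space. -/
  V : Type u
  [addCommGroup : AddCommGroup V]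
  [module : Module ℝ V]
  [finite : Module.Finite ℝ V]
  /-- The linear action of `G`. -/
  ρ : Representation ℝ G V

attribute [instance] FinRep.addCommGroup FinRep.module FinRep.finite

namespace FinRep

variable {G : Type u} [Group G]

/-- Two `ℝG`-modules are isomorphic. -/
def Iso (U W : FinRep G) : Prop := Nonempty (U.ρ.Equiv W.ρ)

instance setoid (G : Type u) [Group G] : Setoid (FinRep G) where
  r := Iso
  iseqv :=
    { refl := fun U => ⟨Representation.Equiv.refl U.ρ⟩
      symm := fun ⟨e⟩ => ⟨e.symm⟩
      trans := fun ⟨e⟩ ⟨f⟩ => ⟨e.trans f⟩ }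

/-- The direct sum of two `ℝG`-modules. -/
def sum (U W : FinRep G) : FinRep G := ⟨U.V × W.V, U.ρ.prod W.ρ⟩

/-- The zero `ℝG`-module. -/
def zero (G : Type u) [Group G] : FinRep G := ⟨PUnit.{u + 1}, 1⟩

/-- The restriction of an `ℝG`-module to a subgroup. -/
def res (P : Subgroup G) (U : FinRep G) : FinRep P := ⟨U.V, U.ρ.comp P.subtype⟩

/-- The `ℝG`-module `ℝ[G] ⊗_{ℝ[H]} U` induced from an `ℝH`-module `U`. -/
def ind [Finite G] (H : Subgroup G) (U : FinRep H) : FinRep G :=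
  haveI : Module.Finite ℝ ℝ[G] := Module.Finite.equiv (MonoidAlgebra.coeffLinearEquiv ℝ).symm
  ⟨Representation.IndV H.subtype U.ρ, Representation.ind H.subtype U.ρ⟩

theorem sum_congr {U U' W W' : FinRep G} (h : Iso U U') (h' : Iso W W') :
    Iso (sum U W) (sum U' W') := by
  obtain ⟨e⟩ := h
  obtain ⟨f⟩ := h'
  refine ⟨Representation.Equiv.mk (e.toLinearEquiv.prodCongr f.toLinearEquiv) fun g => ?_⟩
  refine LinearMap.ext fun v => Prod.ext ?_ ?_
  · exact LinearMap.congr_fun (e.isIntertwining' g) v.1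
  · exact LinearMap.congr_fun (f.isIntertwining' g) v.2

theorem sum_assoc (U W X : FinRep G) : Iso (sum (sum U W) X) (sum U (sum W X)) :=
  ⟨Representation.Equiv.mk (LinearEquiv.prodAssoc ℝ U.V W.V X.V) fun _ => rfl⟩

theorem sum_comm (U W : FinRep G) : Iso (sum U W) (sum W U) :=
  ⟨Representation.Equiv.mk (LinearEquiv.prodComm ℝ U.V W.V) fun _ => rfl⟩

theorem zero_sum (U : FinRep G) : Iso (sum (zero G) U) U :=
  ⟨Representation.Equiv.mk (LinearEquiv.uniqueProd (R := ℝ) (M := U.V) (M₂ := PUnit.{u + 1}))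
    fun _ => rfl⟩

/-- Two `ℝG`-modules have isomorphic restrictions to `P` for each subgroup `P` of prime power
order (the order `1 = p ^ 0` of the trivial subgroup counts as a prime power). -/
def PMatched (U W : FinRep G) : Prop :=
  ∀ P : Subgroup G, (∃ p k : ℕ, p.Prime ∧ Nat.card P = p ^ k) → Iso (res P U) (res P W)

end FinRep

/-- Isomorphism classes of `ℝG`-modules. -/
def IsoClass (G : Type u) [Group G] : Type (u + 1) := Quotient (FinRep.setoid G)

/-- The isomorphism class of an `ℝG`-module. -/
def IsoClass.mk {G : Type u} [Group G] (U : FinRep G) : IsoClass G := Quotient.mk _ U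

instance (G : Type u) [Group G] : Add (IsoClass G) :=
  ⟨Quotient.map₂ FinRep.sum fun _ _ h _ _ h' => FinRep.sum_congr h h'⟩

instance (G : Type u) [Group G] : Zero (IsoClass G) := ⟨IsoClass.mk (FinRep.zero G)⟩

/-- The monoid of isomorphism classes under direct sum. -/
instance (G : Type u) [Group G] : AddCommMonoid (IsoClass G) where
  add_assoc := by
    rintro ⟨a⟩ ⟨b⟩ ⟨c⟩
    exact Quotient.sound (FinRep.sum_assoc a b c)
  add_comm := by
    rintro ⟨a⟩ ⟨b⟩
    exact Quotient.sound (FinRep.sum_comm a b)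
  zero_add := by
    rintro ⟨a⟩
    exact Quotient.sound (FinRep.zero_sum a)
  add_zero := by
    rintro ⟨a⟩
    exact Quotient.sound ((FinRep.setoid G).trans (FinRep.sum_comm a _) (FinRep.zero_sum a))
  nsmul := nsmulRec

/-- `RO(G)`: the Grothendieck group of the monoid of isomorphism classes of `ℝG`-modules. -/
abbrev RO (G : Type u) [Group G] : Type (u + 1) := Algebra.GrothendieckAddGroup (IsoClass G)

/-- The class of an `ℝG`-module in `RO(G)`. -/
def cls {G : Type u} [Group G] (U : FinRep G) : RO G :=
  Algebra.GrothendieckAddGroup.of (IsoClass.mk U)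

theorem cls_sum {G : Type u} [Group G] (U W : FinRep G) :
    cls (FinRep.sum U W) = cls U + cls W := by
  have h : IsoClass.mk (FinRep.sum U W) = IsoClass.mk U + IsoClass.mk W := rfl
  rw [cls, cls, cls, h, map_add]

/-- `PO(G)`: the subgroup of `RO(G)` of the differences `U - W` with `U` and `W` matched on all
subgroups of prime power order. -/
def PO (G : Type u) [Group G] : AddSubgroup (RO G) where
  carrier := {x | ∃ U W : FinRep G, FinRep.PMatched U W ∧ x = cls U - cls W}
  add_mem' := by
    rintro _ _ ⟨U, W, h, rfl⟩ ⟨U', W', h', rfl⟩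
    refine ⟨U.sum U', W.sum W', fun P hP => FinRep.sum_congr (h P hP) (h' P hP), ?_⟩
    rw [cls_sum, cls_sum]
    abel
  zero_mem' := ⟨FinRep.zero G, FinRep.zero G,
    fun _ _ => ⟨Representation.Equiv.refl _⟩, (sub_self _).symm⟩
  neg_mem' := by
    rintro _ ⟨U, W, h, rfl⟩
    exact ⟨W, U, fun P hP => (FinRep.setoid P).symm (h P hP), neg_sub _ _⟩

/-- Induction of `ℝH`-modules on isomorphism classes. -/
def indIsoClass {G : Type u} [Group G] [Finite G] (H : Subgroup G) :
    IsoClass H →+ IsoClass G where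
  toFun := Quotient.map (FinRep.ind H) fun _ _ ⟨e⟩ => ind_congr H.subtype e
  map_zero' := Quotient.sound (by
    have : Subsingleton (Representation.IndV H.subtype (FinRep.zero H).ρ) := by
      have h0 : (LinearMap.id : Representation.IndV H.subtype (FinRep.zero H).ρ →ₗ[ℝ] _) = 0 :=
        Representation.IndV.hom_ext _ _ fun h => LinearMap.ext fun v => by
          have hv : v = 0 := Subsingleton.elim (α := PUnit.{u + 1}) v 0
          rw [hv, map_zero, map_zero]
      exact ⟨fun a b => (LinearMap.congr_fun h0 a).trans (LinearMap.congr_fun h0 b).symm⟩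
    have : Subsingleton (FinRep.ind H (FinRep.zero H)).V := this
    have : Subsingleton (FinRep.zero G).V := inferInstanceAs (Subsingleton PUnit.{u + 1})
    exact ⟨Representation.Equiv.mk 0 fun _ => Subsingleton.elim _ _⟩)
  map_add' := by
    rintro ⟨a⟩ ⟨b⟩
    exact Quotient.sound (ind_prod H.subtype a.ρ b.ρ)

/-- The induction homomorphism `RO(H) → RO(G)`, `U - W ↦ Ind U - Ind W`. -/
def indRO {G : Type u} [Group G] [Finite G] (H : Subgroup G) : RO H →+ RO G :=
  Algebra.GrothendieckAddGroup.lift (Algebra.GrothendieckAddGroup.of.comp (indIsoClass H))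

theorem indRO_cls {G : Type u} [Group G] [Finite G] (H : Subgroup G) (U : FinRep H) :
    indRO H (cls U) = cls (FinRep.ind H U) := by
  have := DFunLike.congr_fun (Algebra.GrothendieckAddGroup.lift.symm_apply_apply
    (Algebra.GrothendieckAddGroup.of.comp (indIsoClass H))) (IsoClass.mk U)
  exact this

/-! ### Real conjugacy classes -/

/-- The real conjugacy class `(g)^± = (g) ∪ (g⁻¹)` of `g` in `G`. -/
def realConjClass {G : Type u} [Group G] (g : G) : Set G := conjugatesOf g ∪ conjugatesOf g⁻¹

/-- The order of `g` is a power of a prime (the order `1 = p ^ 0` included). -/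
def HasPrimePowerOrder {G : Type u} [Group G] (g : G) : Prop :=
  ∃ p k : ℕ, p.Prime ∧ orderOf g = p ^ k

end RealRepRing

end

/-! Characters embed `RO(G)` into the real class functions invariant under inversion, and they span
that space. In these terms `PO(G)` consists of the virtual characters vanishing at all elements of
prime power order (`mem_PO_iff`), and induction is adjoint to restriction
(`classInner_charHom_indRO`). Pairing a virtual character with the indicator of a real conjugacy
class recovers its value there up to a nonzero factor. So induction preserves `PO`, and it is
injective on `PO` when each relevant indicator on `G` restricts to the indicator of a single real
class of `H`.

Conversely, if two real classes of `H` fuse in `G`, a combination `f` of their indicators is killed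
by induction and by restriction to all subgroups of prime power order. This `f` is only a real
combination of characters. To get an integral one, consider `⟨Ind x, Ind y⟩ + ∑ P, ⟨Res x, Res y⟩`,
a positive semidefinite form with integer values on characters. Isotropic elements of `RO(H)` are
exactly those of `PO(H)` killed by induction. Since `f` lies in its radical, the integer Gram matrix
is singular, hence has a nonzero integer null vector, which gives the required element. -/

noncomputable section

namespace RealRepRing

open Representation

/-! ### Characters and their inner products -/

section Character

variable {G : Type*} [Group G] [Finite G] {V W : Type*} [AddCommGroup V] [Module ℝ V]
  [Module.Finite ℝ V] [AddCommGroup W] [Module ℝ W] [Module.Finite ℝ W]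

/-- The character of a real representation takes the same value at an element and its inverse. -/
theorem character_inv (ρ : Representation ℝ G V) (g : G) :
    ρ.character g⁻¹ = ρ.character g := by
  classical
  have := Fintype.ofFinite G
  let b := Module.finBasis ℝ V
  let M : G → Matrix _ _ ℝ := fun k => LinearMap.toMatrix b b (ρ k)
  have hM : ∀ k l, M (k * l) = M k * M l := fun k l => by
    simp only [M, map_mul, Module.End.mul_eq_comp, LinearMap.toMatrix_comp b b b]
  have h1 : M 1 = 1 := by simp only [M, map_one, Module.End.one_eq_id, LinearMap.toMatrix_id]
  -- Averaging yields an invariant inner product, so `M g⁻¹` is similar to the transpose of `M g`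
  -- and has the same trace.
  let B := ∑ k, (M k).transpose * M k
  have hB : B.PosDef := by
    -- The term at `k = 1` is the identity matrix; it makes the semidefinite sum definite.
    have hs : B = 1 + ∑ k ∈ Finset.univ.erase (1 : G), (M k).transpose * M k := by
      have := Finset.add_sum_erase Finset.univ (fun k => (M k).transpose * M k)
        (Finset.mem_univ (1 : G))
      simp only [h1, Matrix.transpose_one, one_mul] at this
      exact this.symm
    rw [hs]
    refine Matrix.PosDef.one.add_posSemidef ?_
    refine Matrix.posSemidef_sum _ fun k _ => ?_
    simpa using Matrix.posSemidef_conjTranspose_mul_self (M k)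
  have hinv : (M g).transpose * B * M g = B := by
    simp only [B, Finset.mul_sum, Finset.sum_mul]
    refine Fintype.sum_equiv (Equiv.mulRight g) _ _ fun k => ?_
    simp [hM, Matrix.transpose_mul, Matrix.mul_assoc]
  have hu : IsUnit B.det := hB.det_pos.ne'.isUnit
  have hMi : M g⁻¹ = B⁻¹ * (M g).transpose * B := by
    have h2 : M g * M g⁻¹ = 1 := by rw [← hM, mul_inv_cancel, h1]
    calc M g⁻¹ = B⁻¹ * B * M g⁻¹ := by rw [Matrix.nonsing_inv_mul _ hu, one_mul]
      _ = B⁻¹ * ((M g).transpose * B * M g) * M g⁻¹ := by rw [hinv]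
      _ = B⁻¹ * (M g).transpose * B * (M g * M g⁻¹) := by simp only [Matrix.mul_assoc]
      _ = _ := by rw [h2, mul_one]
  have ht : ∀ k, ρ.character k = (M k).trace := fun k => LinearMap.trace_eq_matrix_trace ℝ b (ρ k)
  rw [ht, ht, hMi, Matrix.mul_assoc, Matrix.trace_mul_comm, Matrix.mul_assoc,
    Matrix.mul_nonsing_inv _ hu, mul_one, Matrix.trace_transpose]

/-- The normalised inner product of real-valued functions on a finite group. -/
def classInner (G : Type*) [Group G] [Finite G] : LinearMap.BilinForm ℝ (G → ℝ) :=
  letI := Fintype.ofFinite G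
  LinearMap.mk₂ ℝ (fun F F' => (Nat.card G : ℝ)⁻¹ * ∑ g, F g * F' g)
    (fun a b c => by simp only [Pi.add_apply, add_mul, Finset.sum_add_distrib, mul_add])
    (fun r a c => by
      simp only [Pi.smul_apply, smul_eq_mul, Finset.mul_sum]
      exact Finset.sum_congr rfl fun _ _ => by ring)
    (fun a b c => by simp only [Pi.add_apply, mul_add, Finset.sum_add_distrib])
    (fun r a c => by
      simp only [Pi.smul_apply, smul_eq_mul, Finset.mul_sum]
      exact Finset.sum_congr rfl fun _ _ => by ring)

theorem classInner_apply [Fintype G] (F F' : G → ℝ) :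
    classInner G F F' = (Nat.card G : ℝ)⁻¹ * ∑ g, F g * F' g := by
  obtain rfl := Subsingleton.elim (Fintype.ofFinite G) ‹Fintype G›
  rfl

theorem classInner_eq_zero_iff [Fintype G] (F F' : G → ℝ) :
    classInner G F F' = 0 ↔ ∑ g, F g * F' g = 0 := by
  rw [classInner_apply, mul_eq_zero, or_iff_right]
  exact inv_ne_zero (Nat.cast_ne_zero.2 Nat.card_pos.ne')

theorem classInner_comm (F F' : G → ℝ) : classInner G F F' = classInner G F' F := by
  have := Fintype.ofFinite G
  simp only [classInner_apply, mul_comm]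

theorem classInner_self_nonneg (F : G → ℝ) : 0 ≤ classInner G F F := by
  have := Fintype.ofFinite G
  rw [classInner_apply]
  exact mul_nonneg (by positivity) (Finset.sum_nonneg fun _ _ => mul_self_nonneg _)

theorem classInner_self_eq_zero {F : G → ℝ} (h : classInner G F F = 0) : F = 0 := by
  have := Fintype.ofFinite G
  rw [classInner_eq_zero_iff, Finset.sum_eq_zero_iff_of_nonneg fun _ _ => mul_self_nonneg _] at h
  exact funext fun g => mul_self_eq_zero.1 (h g (Finset.mem_univ g))

/-- The inner product of two real characters is the dimension of the space of intertwiners. -/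
theorem classInner_character (ρ : Representation ℝ G V) (σ : Representation ℝ G W) :
    classInner G ρ.character σ.character = Module.finrank ℝ (IntertwiningMap ρ σ) := by
  have := Fintype.ofFinite G
  have : Invertible (Nat.card G : ℝ) := invertibleOfNonzero (Nat.cast_ne_zero.2 Nat.card_pos.ne')
  rw [← card_inv_mul_sum_char_mul_char_eq_finrank, classInner_apply]
  simp only [character_inv, mul_comm]

omit [Finite G] in
theorem character_prod (ρ : Representation ℝ G V) (σ : Representation ℝ G W) :
    (ρ.prod σ).character = ρ.character + σ.character :=
  funext fun g => LinearMap.trace_prodMap' (ρ g) (σ g)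

omit [Finite G] [Module.Finite ℝ V] in
/-- A representation is the direct sum of two complementary subrepresentations. -/
theorem nonempty_equiv_prod_of_isCompl {ρ : Representation ℝ G V} {p q : Subrepresentation ρ}
    (h : IsCompl p q) :
    Nonempty ((p.toRepresentation.prod q.toRepresentation).Equiv ρ) := by
  have h' : IsCompl p.toSubmodule q.toSubmodule := by
    refine IsCompl.of_eq ?_ ?_
    · rw [← Subrepresentation.toSubmodule_inf, h.inf_eq_bot]; rfl
    · rw [← Subrepresentation.toSubmodule_sup, h.sup_eq_top]; rfl
  refine ⟨Representation.Equiv.mk (Submodule.prodEquivOfIsCompl _ _ h') fun g => ?_⟩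
  refine LinearMap.ext fun v => ?_
  simp [Subrepresentation.toRepresentation]

end Character

/-! ### Characters determine real representations -/

namespace FinRep

variable {G : Type u} [Group G] [Finite G]

/-- The `ℝG`-module afforded by a subrepresentation. -/
def sub (U : FinRep G) (p : Subrepresentation U.ρ) : FinRep G := ⟨p.toSubmodule, p.toRepresentation⟩

omit [Finite G] in
theorem character_sum (U W : FinRep G) :
    (sum U W).ρ.character = U.ρ.character + W.ρ.character :=
  character_prod U.ρ W.ρ

/-- Real representations of a finite group with the same character are isomorphic. -/
theorem iso_of_character_eq {U W : FinRep G} (h : U.ρ.character = W.ρ.character) : Iso U W := by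
  induction hn : Module.finrank ℝ U.V using Nat.strong_induction_on generalizing U W with
  | _ n ih =>
  have hd : Module.finrank ℝ U.V = Module.finrank ℝ W.V := by
    have := congrFun h 1
    rw [char_one, char_one] at this
    exact_mod_cast this
  rcases Nat.eq_zero_or_pos n with rfl | hpos
  · have : Subsingleton U.V := Module.finrank_zero_iff.1 hn
    have : Subsingleton W.V := Module.finrank_zero_iff.1 (hd ▸ hn)
    exact ⟨Representation.Equiv.mk 0 fun _ => Subsingleton.elim _ _⟩
  have hU : Nontrivial U.V := Module.nontrivial_of_finrank_pos (R := ℝ) (hn ▸ hpos)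
  -- Equal characters force `Hom(U, W)` and `Hom(U, U)` to have the same dimension, and the latter
  -- contains the identity.
  have hne : Nontrivial (IntertwiningMap U.ρ W.ρ) := by
    have h0 : Nontrivial (IntertwiningMap U.ρ U.ρ) := by
      obtain ⟨v, hv⟩ := exists_ne (0 : U.V)
      exact ⟨⟨1, 0, fun e => hv (DFunLike.congr_fun e v)⟩⟩
    have h1 := classInner_character U.ρ W.ρ
    rw [← h, classInner_character] at h1
    refine Module.nontrivial_of_finrank_pos (R := ℝ) ?_
    rw [← Nat.cast_injective h1]
    exact Module.finrank_pos
  obtain ⟨φ, hφ⟩ := exists_ne (0 : IntertwiningMap U.ρ W.ρ)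
  obtain ⟨C, hC⟩ := exists_isCompl φ.ker
  obtain ⟨D, hD⟩ := exists_isCompl φ.range
  obtain ⟨eU⟩ : Iso (sum (sub U φ.ker) (sub U C)) U := nonempty_equiv_prod_of_isCompl hC
  obtain ⟨eW⟩ : Iso (sum (sub W φ.range) (sub W D)) W := nonempty_equiv_prod_of_isCompl hD
  have hCr : Iso (sub U C) (sub W φ.range) := by
    let ψ : IntertwiningMap C.toRepresentation φ.range.toRepresentation :=
      ⟨(φ.toLinearMap.comp C.toSubmodule.subtype).codRestrict _ fun v => ⟨_, rfl⟩, fun g => by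
        refine LinearMap.ext fun v => Subtype.ext ?_
        exact LinearMap.congr_fun (φ.isIntertwining' g) v.1⟩
    refine ⟨ψ.ofBijective ⟨?_, ?_⟩⟩
    · refine (injective_iff_map_eq_zero ψ).2 fun v hv => Subtype.ext ?_
      have h1 : v.1 ∈ φ.ker := congrArg Subtype.val hv
      have h2 : v.1 ∈ φ.ker ⊓ C := ⟨h1, v.2⟩
      rw [hC.inf_eq_bot] at h2
      exact h2
    · rintro ⟨_, u, rfl⟩
      have hu : u ∈ φ.ker ⊔ C := by rw [hC.sup_eq_top]; exact Submodule.mem_top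
      obtain ⟨a, ha, c, hc, rfl⟩ := Submodule.mem_sup.1 hu
      refine ⟨⟨c, hc⟩, Subtype.ext ?_⟩
      have ha' : φ a = 0 := ha
      change φ c = φ (a + c)
      rw [map_add, ha', zero_add]
  -- Cancelling the characters of the isomorphic summands `C` and `φ.range` leaves equal characters,
  -- and `φ ≠ 0` makes the kernel smaller than `U`.
  have hKD : Iso (sub U φ.ker) (sub W D) := by
    refine ih _ ?_ ?_ rfl
    · rw [← hn]
      refine Submodule.finrank_lt fun e => hφ ?_
      exact IntertwiningMap.ext (LinearMap.ker_eq_top.1 e)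
    · obtain ⟨e⟩ := hCr
      have h1 := char_iso eU
      have h2 := char_iso eW
      have h3 := char_iso e
      rw [character_sum] at h1 h2
      rw [← h, ← h1, h3, add_comm] at h2
      exact (add_right_cancel h2).symm
  exact (FinRep.setoid G).trans ⟨eU.symm⟩ ((FinRep.setoid G).trans (sum_congr hKD hCr)
    ((FinRep.setoid G).trans (sum_comm _ _) ⟨eW⟩))

end FinRep

/-- The real-valued class functions that are invariant under inversion. -/
def realClassFunctions (G : Type*) [Group G] : Submodule ℝ (G → ℝ) where
  carrier := {F | (∀ g k, F (k * g * k⁻¹) = F g) ∧ ∀ g, F g⁻¹ = F g}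
  add_mem' ha hb := ⟨fun g k => congrArg₂ (· + ·) (ha.1 g k) (hb.1 g k),
    fun g => congrArg₂ (· + ·) (ha.2 g) (hb.2 g)⟩
  zero_mem' := ⟨fun _ _ => rfl, fun _ => rfl⟩
  smul_mem' r _ ha := ⟨fun g k => congrArg (r * ·) (ha.1 g k), fun g => congrArg (r * ·) (ha.2 g)⟩

/-! ### Characters span the real class functions -/

section Span

variable {G : Type u} [Group G] [Finite G]

theorem character_mem_realClassFunctions (U : FinRep G) :
    U.ρ.character ∈ realClassFunctions G :=
  ⟨fun g k => char_conj U.ρ g k, character_inv U.ρ⟩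

/-- The left regular representation on the Euclidean space of functions on the group. -/
def euclideanRegular (G : Type*) [Group G] : Representation ℝ G (EuclideanSpace ℝ G) where
  toFun g :=
    { toFun := fun v => WithLp.toLp 2 fun x => v (g⁻¹ * x)
      map_add' := fun _ _ => rfl
      map_smul' := fun _ _ => rfl }
  map_one' := by ext; simp
  map_mul' g h := by
    ext v x
    change v ((g * h)⁻¹ * x) = v (h⁻¹ * (g⁻¹ * x))
    rw [mul_inv_rev, mul_assoc]

omit [Finite G] in
theorem euclideanRegular_apply (g : G) (v : EuclideanSpace ℝ G) (x : G) :
    euclideanRegular G g v x = v (g⁻¹ * x) := rfl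

/-- A real class function orthogonal to all real characters vanishes. -/
theorem eq_zero_of_classInner_character_eq_zero {f : G → ℝ} (hf : f ∈ realClassFunctions G)
    (h : ∀ U : FinRep G, classInner G f U.ρ.character = 0) : f = 0 := by
  classical
  have := Fintype.ofFinite G
  let R := euclideanRegular G
  -- Conjugation invariance of `f` makes `T` equivariant; inversion invariance makes it symmetric,
  -- hence diagonalizable over `ℝ`.
  let T : EuclideanSpace ℝ G →ₗ[ℝ] EuclideanSpace ℝ G := ∑ g, f g • R g
  have hT : ∀ v x, T v x = ∑ g, f g * v (g⁻¹ * x) := fun v x => by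
    simp only [T, LinearMap.sum_apply, LinearMap.smul_apply, WithLp.ofLp_sum, WithLp.ofLp_smul,
      Finset.sum_apply, Pi.smul_apply, smul_eq_mul]
    rfl
  have hcomm : ∀ k v, T (R k v) = R k (T v) := fun k v => by
    ext x
    rw [hT, euclideanRegular_apply, hT]
    refine Fintype.sum_equiv (MulAut.conj k⁻¹).toEquiv _ _ fun g => ?_
    rw [euclideanRegular_apply]
    simp only [MulEquiv.toEquiv_eq_coe, MulEquiv.coe_toEquiv, MulAut.conj_apply]
    rw [hf.1]
    congr 2
    group
  have hsymm : T.IsSymmetric := fun v w => by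
    simp only [PiLp.inner_apply, hT, RCLike.inner_apply, conj_trivial, Finset.mul_sum,
      Finset.sum_mul]
    rw [Finset.sum_comm]
    conv_rhs => rw [Finset.sum_comm]
    refine Fintype.sum_equiv (Equiv.inv G) _ _ fun g => ?_
    refine Fintype.sum_equiv (Equiv.mulLeft g⁻¹) _ _ fun x => ?_
    simp [hf.2]
    ring
  -- The eigenspace is a subrepresentation; the trace of `T` on it is `μ` times its dimension, and
  -- is zero by orthogonality to its character.
  have hzero : ∀ μ, Module.End.HasEigenvalue T μ → μ = 0 := fun μ hμ => by
    let E : Subrepresentation R :=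
      ⟨Module.End.eigenspace T μ, fun g v hv => by
        rw [Module.End.mem_eigenspace_iff] at hv ⊢
        rw [hcomm, hv, map_smul]⟩
    have h1 := h ⟨E.toSubmodule, E.toRepresentation⟩
    rw [classInner_eq_zero_iff] at h1
    have h2 : ∑ g, f g * E.toRepresentation.character g =
        LinearMap.trace ℝ E.toSubmodule (∑ g, f g • E.toRepresentation g) := by
      simp [Representation.character]
    have h3 : ∑ g, f g • E.toRepresentation g = μ • LinearMap.id := by
      refine LinearMap.ext fun v => Subtype.ext ?_
      have h4 := Module.End.mem_eigenspace_iff.1 v.2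
      simp only [T, LinearMap.sum_apply, LinearMap.smul_apply] at h4
      simp only [LinearMap.sum_apply, LinearMap.smul_apply, AddSubmonoidClass.coe_finsetSum,
        LinearMap.id_apply]
      exact h4
    rw [h2, h3, map_smul, LinearMap.trace_id, smul_eq_mul, mul_eq_zero] at h1
    refine h1.resolve_right ?_
    have : Nontrivial E.toSubmodule := Submodule.nontrivial_iff_ne_bot.2 hμ
    exact_mod_cast (Module.finrank_pos (R := ℝ) (M := E.toSubmodule)).ne'
  have hT0 : T = 0 := by
    refine (hsymm.eigenvectorBasis rfl).toBasis.ext fun i => ?_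
    rw [OrthonormalBasis.coe_toBasis, hsymm.apply_eigenvectorBasis,
      hzero _ (hsymm.hasEigenvalue_eigenvalues rfl i)]
    simp
  funext x
  -- Applied to the delta function at `1`, the operator `T` returns `f`.
  have := hT (EuclideanSpace.single 1 1) x
  rw [hT0] at this
  simpa [mul_comm, inv_mul_eq_one] using this.symm

/-- The real characters span the space of real class functions. -/
theorem span_character :
    Submodule.span ℝ (Set.range fun U : FinRep G => U.ρ.character) = realClassFunctions G := by
  have := Fintype.ofFinite G
  set S := Submodule.span ℝ (Set.range fun U : FinRep G => U.ρ.character)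
  have hle : S ≤ realClassFunctions G :=
    Submodule.span_le.2 (Set.range_subset_iff.2 character_mem_realClassFunctions)
  refine le_antisymm hle fun f hf => ?_
  let e := WithLp.linearEquiv 2 ℝ (G → ℝ)
  let S' : Submodule ℝ (EuclideanSpace ℝ G) := S.comap e.toLinearMap
  let R' : Submodule ℝ (EuclideanSpace ℝ G) := (realClassFunctions G).comap e.toLinearMap
  have hle' : S' ≤ R' := Submodule.comap_mono hle
  have hf' : e.symm f ∈ S' ⊔ S'ᗮ ⊓ R' := by
    rw [Submodule.sup_orthogonal_inf_of_hasOrthogonalProjection hle']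
    exact hf
  obtain ⟨a, ha, b, ⟨hb, hbR⟩, hab⟩ := Submodule.mem_sup.1 hf'
  have hb0 : e b = 0 := eq_zero_of_classInner_character_eq_zero hbR fun U => by
    have h1 := hb (e.symm U.ρ.character) (Submodule.subset_span ⟨U, rfl⟩)
    rw [classInner_eq_zero_iff]
    simpa [PiLp.inner_apply] using! h1
  have h2 := congrArg e hab
  rw [map_add, hb0, add_zero, LinearEquiv.apply_symm_apply] at h2
  exact h2 ▸ ha

end Span

/-! ### Frobenius reciprocity -/

section Induction

variable {G : Type u} [Group G] [Finite G] (H : Subgroup G)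

/-- Frobenius reciprocity for real representations. -/
def indResEquiv (U : FinRep H) (W : FinRep G) :
    IntertwiningMap (FinRep.ind H U).ρ W.ρ ≃ₗ[ℝ] IntertwiningMap U.ρ (FinRep.res H W).ρ where
  toFun f := ⟨f.toLinearMap ∘ₗ IndV.mk H.subtype U.ρ 1, fun g => by
    have := (Rep.indResHomEquiv H.subtype (Rep.of U.ρ) (Rep.of W.ρ) (Rep.ofHom f)).hom.2 g
    exact this⟩
  map_add' _ _ := rfl
  map_smul' _ _ := rfl
  invFun f := ((Rep.indResHomEquiv H.subtype (Rep.of U.ρ) (Rep.of W.ρ)).symm (Rep.ofHom f)).hom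
  left_inv f := congrArg Rep.Hom.hom
    ((Rep.indResHomEquiv H.subtype (Rep.of U.ρ) (Rep.of W.ρ)).symm_apply_apply (Rep.ofHom f))
  right_inv f := congrArg Rep.Hom.hom
    ((Rep.indResHomEquiv H.subtype (Rep.of U.ρ) (Rep.of W.ρ)).apply_symm_apply (Rep.ofHom f))

/-- Both sides are linear in `F`, so by `span_character` it suffices to treat characters, where
reciprocity equates dimensions of intertwiner spaces. -/
theorem classInner_character_ind (U : FinRep H) {F : G → ℝ} (hF : F ∈ realClassFunctions G) :
    classInner G (FinRep.ind H U).ρ.character F =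
      classInner H U.ρ.character (F ∘ Subtype.val) := by
  rw [← span_character] at hF
  induction hF using Submodule.span_induction with
  | mem _ hx =>
    obtain ⟨W, rfl⟩ := hx
    have : (W.ρ.character ∘ Subtype.val : H → ℝ) = (FinRep.res H W).ρ.character := rfl
    rw [this, classInner_character, classInner_character, (indResEquiv H U W).finrank_eq]
  | zero => exact (map_zero _).trans (map_zero _).symm
  | add x y _ _ hx hy =>
    rw [map_add, hx, hy, ← map_add]; rfl
  | smul a x _ hx =>
    rw [map_smul, hx, ← map_smul]; rfl

end Induction

/-! ### Virtual characters and `PO` -/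

section CharHom

variable {G : Type u} [Group G]

/-- The character of a virtual real representation. -/
def charHom (G : Type u) [Group G] : RO G →+ (G → ℝ) :=
  Algebra.GrothendieckAddGroup.lift
    { toFun := Quotient.lift (fun U : FinRep G => U.ρ.character) fun _ _ ⟨e⟩ => char_iso e
      map_zero' := funext fun _ => (LinearMap.trace ℝ PUnit.{u + 1}).map_zero
      map_add' := by
        rintro ⟨a⟩ ⟨b⟩
        exact FinRep.character_sum a b }

theorem charHom_cls (U : FinRep G) : charHom G (cls U) = U.ρ.character :=
  DFunLike.congr_fun (Algebra.GrothendieckAddGroup.lift.symm_apply_apply _) (IsoClass.mk U)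

theorem exists_eq_cls_sub_cls (x : RO G) : ∃ U W : FinRep G, x = cls U - cls W := by
  obtain ⟨⟨⟨a⟩, ⟨⟨b⟩, hb⟩⟩, h⟩ := (AddLocalization.addMonoidOf ⊤).surj x
  exact ⟨a, b, eq_sub_of_add_eq h⟩

theorem charHom_injective [Finite G] : Function.Injective (charHom G) := by
  refine (injective_iff_map_eq_zero _).2 fun x hx => ?_
  obtain ⟨U, W, rfl⟩ := exists_eq_cls_sub_cls x
  rw [map_sub, charHom_cls, charHom_cls, sub_eq_zero] at hx
  have : IsoClass.mk U = IsoClass.mk W := Quotient.sound (FinRep.iso_of_character_eq hx)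
  rw [cls, cls, this, sub_self]

theorem charHom_mem [Finite G] (x : RO G) : charHom G x ∈ realClassFunctions G := by
  obtain ⟨U, W, rfl⟩ := exists_eq_cls_sub_cls x
  rw [map_sub, charHom_cls, charHom_cls]
  exact sub_mem (character_mem_realClassFunctions U) (character_mem_realClassFunctions W)

/-- Elements of prime power order are those lying in some subgroup of prime power order, and
restrictions to such subgroups are determined by their characters. -/
theorem mem_PO_iff [Finite G] {x : RO G} :
    x ∈ PO G ↔ ∀ g, HasPrimePowerOrder g → charHom G x g = 0 := by
  constructor
  · rintro ⟨U, W, h, rfl⟩ g ⟨p, k, hp, hk⟩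
    obtain ⟨e⟩ := h (Subgroup.zpowers g) ⟨p, k, hp, by rw [Nat.card_zpowers, hk]⟩
    have := congrFun (char_iso e) ⟨g, Subgroup.mem_zpowers g⟩
    rw [map_sub, charHom_cls, charHom_cls]
    exact sub_eq_zero.2 this
  · intro h
    obtain ⟨U, W, rfl⟩ := exists_eq_cls_sub_cls x
    refine ⟨U, W, fun P hP => FinRep.iso_of_character_eq (funext fun g => ?_), rfl⟩
    obtain ⟨p, k, hp, hk⟩ := hP
    rw [map_sub, charHom_cls, charHom_cls] at h
    refine sub_eq_zero.1 (h g ?_)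
    obtain ⟨j, -, hj⟩ := (Nat.dvd_prime_pow hp).1 (hk ▸ orderOf_dvd_natCard g)
    exact ⟨p, j, hp, by rw [Subgroup.orderOf_coe, hj]⟩

theorem classInner_charHom_indRO [Finite G] (H : Subgroup G) (x : RO H) {F : G → ℝ}
    (hF : F ∈ realClassFunctions G) :
    classInner G (charHom G (indRO H x)) F = classInner H (charHom H x) (F ∘ Subtype.val) := by
  obtain ⟨U, W, rfl⟩ := exists_eq_cls_sub_cls x
  simp only [map_sub, indRO_cls, charHom_cls, LinearMap.sub_apply,
    classInner_character_ind H _ hF]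

end CharHom

/-! ### Real conjugacy classes and their indicators -/

section RealConjClass

variable {G : Type u} [Group G]

theorem mem_realConjClass_self (g : G) : g ∈ realConjClass g := Or.inl (IsConj.refl g)

theorem conj_mem_realConjClass_iff {g x : G} (k : G) :
    k * x * k⁻¹ ∈ realConjClass g ↔ x ∈ realConjClass g := by
  have h : IsConj x (k * x * k⁻¹) := isConj_iff.2 ⟨k, rfl⟩
  exact or_congr ⟨fun a => a.trans h.symm, fun a => a.trans h⟩
    ⟨fun a => a.trans h.symm, fun a => a.trans h⟩

theorem isConj_inv_iff {x y : G} : IsConj x⁻¹ y⁻¹ ↔ IsConj x y := by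
  simp only [isConj_iff, ← conj_inv, inv_inj]

theorem inv_mem_realConjClass_iff {g x : G} :
    x⁻¹ ∈ realConjClass g ↔ x ∈ realConjClass g := by
  have h : IsConj g x⁻¹ ↔ IsConj g⁻¹ x := by rw [← isConj_inv_iff, inv_inv]
  exact (or_congr h isConj_inv_iff).trans or_comm

theorem orderOf_eq_of_mem_realConjClass {g x : G} (h : x ∈ realConjClass g) :
    orderOf x = orderOf g := by
  rcases h with h | h <;> obtain ⟨k, rfl⟩ := isConj_iff.1 h
  · exact orderOf_injective (MulAut.conj k).toMonoidHom (MulAut.conj k).injective g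
  · exact (orderOf_injective (MulAut.conj k).toMonoidHom (MulAut.conj k).injective g⁻¹).trans
      (orderOf_inv g)

theorem apply_eq_of_mem_realConjClass {F : G → ℝ} (hF : F ∈ realClassFunctions G) {g x : G}
    (h : x ∈ realConjClass g) : F x = F g := by
  rcases h with h | h <;> obtain ⟨k, rfl⟩ := isConj_iff.1 h
  · exact hF.1 g k
  · exact (hF.1 _ k).trans (hF.2 g)

theorem mem_realConjClass_symm {g x : G} (h : x ∈ realConjClass g) : g ∈ realConjClass x := by
  rcases h with h | h
  · exact Or.inl (IsConj.symm h)
  · refine Or.inr ?_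
    have := isConj_inv_iff.2 (IsConj.symm h)
    rwa [inv_inv] at this

theorem indicator_mem_realClassFunctions (g : G) :
    (realConjClass g).indicator 1 ∈ realClassFunctions G := by
  classical
  refine ⟨fun x k => ?_, fun x => ?_⟩
  · simp only [Set.indicator_apply, conj_mem_realConjClass_iff]; rfl
  · simp only [Set.indicator_apply, inv_mem_realConjClass_iff]; rfl

theorem image_realConjClass_subset (H : Subgroup G) (h : H) :
    Subtype.val '' realConjClass h ⊆ realConjClass (h : G) ∩ (H : Set G) := by
  rintro _ ⟨x, hx, rfl⟩
  exact ⟨hx.imp (H.subtype.map_isConj (a := h) (b := x))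
    (H.subtype.map_isConj (a := h⁻¹) (b := x)), x.2⟩

theorem classInner_indicator [Finite G] {F : G → ℝ} {S : Set G} {g : G}
    (hF : ∀ x ∈ S, F x = F g) :
    classInner G F (S.indicator 1) = (Nat.card G : ℝ)⁻¹ * (S.ncard * F g) := by
  classical
  have := Fintype.ofFinite G
  rw [classInner_apply]
  congr 1
  have : ∀ x, F x * S.indicator 1 x = if x ∈ S then F g else 0 := fun x => by
    by_cases hx : x ∈ S <;> simp [hx, hF]
  simp only [this]
  rw [Finset.sum_ite, Finset.sum_const, Finset.sum_const_zero, add_zero, nsmul_eq_mul,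
    Set.ncard_eq_toFinset_card']
  congr 3
  ext; simp

theorem apply_eq_zero_of_classInner_indicator [Finite G] {F : G → ℝ} {S : Set G} {g : G}
    (hg : g ∈ S) (hF : ∀ x ∈ S, F x = F g) (h : classInner G F (S.indicator 1) = 0) :
    F g = 0 := by
  rw [classInner_indicator hF] at h
  have h1 : (Nat.card G : ℝ) ≠ 0 := Nat.cast_ne_zero.2 Nat.card_pos.ne'
  have h2 : (S.ncard : ℝ) ≠ 0 :=
    Nat.cast_ne_zero.2 (Set.ncard_ne_zero_of_mem hg (Set.toFinite _))
  simpa [h1, h2] using h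

end RealConjClass

/-! ### Induction on `PO` -/

section Main

variable {G : Type u} [Group G] [Finite G] (H : Subgroup G)

theorem indRO_mem_PO {x : RO H} (hx : x ∈ PO H) : indRO H x ∈ PO G := by
  classical
  have := Fintype.ofFinite H
  rw [mem_PO_iff] at hx ⊢
  intro g hg
  refine apply_eq_zero_of_classInner_indicator (mem_realConjClass_self g)
    (fun y hy => apply_eq_of_mem_realConjClass (charHom_mem _) hy) ?_
  rw [classInner_charHom_indRO H x (indicator_mem_realClassFunctions g), classInner_eq_zero_iff]
  -- Any `h` in the real class of `g` has the order of `g`, a prime power, so the character of `x`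
  -- vanishes there.
  refine Finset.sum_eq_zero fun h _ => ?_
  by_cases hh : (h : G) ∈ realConjClass g
  · obtain ⟨p, k, hp, hk⟩ := hg
    rw [hx h ⟨p, k, hp, by rw [← Subgroup.orderOf_coe, orderOf_eq_of_mem_realConjClass hh, hk]⟩,
      zero_mul]
  · rw [Function.comp_apply, Set.indicator_of_notMem hh, mul_zero]

/-- Without fusion, the indicator of the real class of `h` in `G` restricts to that of its real
class in `H`. By reciprocity the character of `x` pairs to zero with it. -/
theorem eq_zero_of_indRO_eq_zero
    (hH : ∀ h : H, ¬ HasPrimePowerOrder h →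
      realConjClass (h : G) ∩ (H : Set G) = Subtype.val '' realConjClass h)
    {x : RO H} (hx : x ∈ PO H) (h0 : indRO H x = 0) : x = 0 := by
  refine charHom_injective ?_
  rw [map_zero]
  funext h
  by_cases hh : HasPrimePowerOrder h
  · exact mem_PO_iff.1 hx h hh
  refine apply_eq_zero_of_classInner_indicator (mem_realConjClass_self h)
    (fun y hy => apply_eq_of_mem_realConjClass (charHom_mem _) hy) ?_
  have h1 := classInner_charHom_indRO H x (indicator_mem_realClassFunctions (h : G))
  rw [h0, map_zero, map_zero, LinearMap.zero_apply] at h1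
  rw [h1]
  congr 1
  have h2 : ((realConjClass (h : G)).indicator 1 : G → ℝ) ∘ (Subtype.val : H → G) =
      (Subtype.val ⁻¹' realConjClass (h : G)).indicator 1 := rfl
  rw [h2]
  congr 1
  ext y
  constructor
  · intro hy
    exact (image_realConjClass_subset H h ⟨y, hy, rfl⟩).1
  · intro hy
    have : (y : G) ∈ Subtype.val '' realConjClass h := hH h hh ▸ ⟨hy, y.2⟩
    obtain ⟨z, hz, e⟩ := this
    exact Subtype.ext e ▸ hz

/-- The subgroups of prime power order. -/
abbrev PrimePowerSubgroup (G : Type u) [Group G] : Type u :=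
  {P : Subgroup G // ∃ p k : ℕ, p.Prime ∧ Nat.card P = p ^ k}

/-- The linear functional on functions on `H` which pairs with the induced virtual character of
`x` and with the restrictions of the virtual character of `x` to subgroups of prime power order. -/
def matchingForm : RO H →+ Module.Dual ℝ (H → ℝ) :=
  letI := Fintype.ofFinite (PrimePowerSubgroup H)
  AddMonoidHom.mk' (fun x =>
    (classInner H).flip (LinearMap.funLeft ℝ ℝ Subtype.val (charHom G (indRO H x))) +
      ∑ P : PrimePowerSubgroup H,
        ((classInner P.1).flip (LinearMap.funLeft ℝ ℝ Subtype.val (charHom H x))) ∘ₗ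
          LinearMap.funLeft ℝ ℝ Subtype.val) fun x y => by
    refine LinearMap.ext fun F => ?_
    simp only [map_add, LinearMap.add_apply, LinearMap.add_comp, Finset.sum_add_distrib]
    ring

theorem matchingForm_apply [Fintype (PrimePowerSubgroup H)] (x : RO H) (F : H → ℝ) :
    matchingForm H x F = classInner H F (charHom G (indRO H x) ∘ Subtype.val) +
      ∑ P : PrimePowerSubgroup H,
        classInner P.1 (F ∘ Subtype.val) (charHom H x ∘ Subtype.val) := by
  obtain rfl := Subsingleton.elim (Fintype.ofFinite (PrimePowerSubgroup H)) ‹_›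
  simp only [matchingForm, AddMonoidHom.mk'_apply, LinearMap.add_apply, LinearMap.sum_apply]
  rfl

/-- Each term of the form is the dimension of a space of intertwiners. -/
theorem exists_int_matchingForm_cls (U W : FinRep H) :
    ∃ n : ℤ, matchingForm H (cls W) U.ρ.character = n := by
  have := Fintype.ofFinite (PrimePowerSubgroup H)
  rw [matchingForm_apply, indRO_cls, charHom_cls, charHom_cls]
  refine ⟨(Module.finrank ℝ (IntertwiningMap U.ρ (FinRep.res H (FinRep.ind H W)).ρ) +
    ∑ P : PrimePowerSubgroup H, Module.finrank ℝ
      (IntertwiningMap (FinRep.res P.1 U).ρ (FinRep.res P.1 W).ρ) : ℕ), ?_⟩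
  push_cast
  rw [← classInner_character]
  simp only [← classInner_character]
  rfl

/-- By reciprocity the value is the squared norm of the induced character plus those of the
restrictions, so each summand vanishes. -/
theorem mem_PO_of_matchingForm_self {x : RO H} (h : matchingForm H x (charHom H x) = 0) :
    x ∈ PO H ∧ indRO H x = 0 := by
  have := Fintype.ofFinite (PrimePowerSubgroup H)
  rw [matchingForm_apply, ← classInner_charHom_indRO H x (charHom_mem _),
    add_eq_zero_iff_of_nonneg (classInner_self_nonneg _)
      (Finset.sum_nonneg fun _ _ => classInner_self_nonneg _),
    Finset.sum_eq_zero_iff_of_nonneg fun _ _ => classInner_self_nonneg _] at h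
  refine ⟨mem_PO_iff.2 fun g ⟨p, k, hp, hk⟩ => ?_,
    charHom_injective ((classInner_self_eq_zero h.1).trans (map_zero _).symm)⟩
  exact congrFun (classInner_self_eq_zero
    (h.2 ⟨Subgroup.zpowers g, p, k, hp, by rw [Nat.card_zpowers, hk]⟩ (Finset.mem_univ _)))
    ⟨g, Subgroup.mem_zpowers g⟩

omit [Finite G] in
/-- An integer matrix with a nonzero real null vector has a nonzero integer null vector. -/
theorem exists_int_vecMul_eq_zero {ι : Type*} [Fintype ι] (A : Matrix ι ι ℤ) {c : ι → ℝ}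
    (hc : c ≠ 0) (h : ∀ j, ∑ i, c i * A i j = 0) :
    ∃ z : ι → ℤ, z ≠ 0 ∧ ∀ j, ∑ i, z i * A i j = 0 := by
  classical
  -- Singularity is read off the determinant, which is the same integer over `ℤ` and `ℝ`.
  have h1 : (A.map (Int.castRingHom ℝ)).det = 0 :=
    Matrix.exists_vecMul_eq_zero_iff.1 ⟨c, hc, funext h⟩
  rw [← RingHom.mapMatrix_apply, ← RingHom.map_det] at h1
  obtain ⟨z, hz, hA⟩ := Matrix.exists_vecMul_eq_zero_iff.2 (Int.cast_eq_zero.1 h1)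
  exact ⟨z, hz, congrFun hA⟩

/-- Passes from a real vector in the radical to an integral one, through the Gram matrix of a basis
made of genuine characters. -/
theorem exists_ne_zero_mem_PO_of_matchingForm {f : H → ℝ} (hf : f ∈ realClassFunctions H)
    (hf0 : f ≠ 0) (h : ∀ x, matchingForm H x f = 0) :
    ∃ x ∈ PO H, x ≠ 0 ∧ indRO H x = 0 := by
  obtain ⟨b, hbs, hspan, hb⟩ := exists_linearIndependent ℝ
    (Set.range fun U : FinRep H => U.ρ.character)
  have := hb.setFinite.fintype
  choose U hU using fun i : b => hbs i.2
  simp only at hU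
  rw [← span_character, ← hspan, ← Subtype.range_coe (s := b),
    Submodule.mem_span_range_iff_exists_fun] at hf
  obtain ⟨c, hc⟩ := hf
  choose A hA using fun i j => exists_int_matchingForm_cls H (U i) (U j)
  obtain ⟨z, hz, hzA⟩ := exists_int_vecMul_eq_zero A (c := c)
    (fun e => hf0 (by rw [← hc, e]; simp)) fun j => by
      rw [← h (cls (U j)), ← hc, map_sum]
      exact Finset.sum_congr rfl fun i _ => by rw [map_smul, ← hU i, hA, smul_eq_mul]
  let x : RO H := ∑ i, z i • cls (U i)
  have hx : charHom H x = ∑ i, (z i : ℝ) • (i : H → ℝ) := by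
    simp only [x, map_sum, map_zsmul, charHom_cls, hU, Int.cast_smul_eq_zsmul]
  have hx0 : matchingForm H x (charHom H x) = 0 := by
    have h1 : ∀ j, matchingForm H (cls (U j)) (charHom H x) = 0 := fun j => by
      rw [hx, map_sum]
      have := congrArg (Int.cast : ℤ → ℝ) (hzA j)
      push_cast at this
      rw [← this]
      exact Finset.sum_congr rfl fun i _ => by rw [map_smul, ← hU i, hA, smul_eq_mul]
    have h2 : matchingForm H x = ∑ j, z j • matchingForm H (cls (U j)) := by
      simp only [x, map_sum, map_zsmul]
    rw [h2, LinearMap.sum_apply]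
    exact Finset.sum_eq_zero fun j _ => by rw [LinearMap.smul_apply, h1, smul_zero]
  obtain ⟨hPO, hind⟩ := mem_PO_of_matchingForm_self H hx0
  refine ⟨x, hPO, fun e => hz (funext fun i => ?_), hind⟩
  rw [e, map_zero] at hx
  exact_mod_cast Fintype.linearIndependent_iff.1 hb (fun i => (z i : ℝ)) hx.symm i

/-- If two real conjugacy classes of `H` consisting of elements whose order is not a prime power
fuse in `G`, then induction is not injective on `PO(H)`. -/
theorem exists_ne_zero_mem_PO_of_fusion {h h' : H} (hh : ¬ HasPrimePowerOrder h)
    (hG : (h' : G) ∈ realConjClass (h : G)) (hH : h' ∉ realConjClass h) :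
    ∃ x ∈ PO H, x ≠ 0 ∧ indRO H x = 0 := by
  have := Fintype.ofFinite (PrimePowerSubgroup H)
  let C := realConjClass h
  let C' := realConjClass h'
  -- The weights balance the class sizes, so that `f` is orthogonal to every real class function
  -- agreeing at `h` and `h'`.
  let f : H → ℝ := (C'.ncard : ℝ) • C.indicator 1 - (C.ncard : ℝ) • C'.indicator 1
  have hord : orderOf h' = orderOf h := by
    rw [← Subgroup.orderOf_coe, ← Subgroup.orderOf_coe, orderOf_eq_of_mem_realConjClass hG]
  have hf : f ∈ realClassFunctions H :=
    sub_mem (Submodule.smul_mem _ _ (indicator_mem_realClassFunctions h))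
      (Submodule.smul_mem _ _ (indicator_mem_realClassFunctions h'))
  have hfv : ∀ y, HasPrimePowerOrder y → f y = 0 := by
    rintro y ⟨p, k, hp, hk⟩
    have h1 : y ∉ C := fun hy => hh ⟨p, k, hp, by rw [← orderOf_eq_of_mem_realConjClass hy, hk]⟩
    have h2 : y ∉ C' := fun hy =>
      hh ⟨p, k, hp, by rw [← hord, ← orderOf_eq_of_mem_realConjClass hy, hk]⟩
    simp [f, h1, h2]
  refine exists_ne_zero_mem_PO_of_matchingForm H hf (fun e => ?_) fun x => ?_
  · have h1 : h ∈ C := mem_realConjClass_self h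
    have h2 : h ∉ C' := fun a => hH (mem_realConjClass_symm a)
    have h3 : (C'.ncard : ℝ) ≠ 0 :=
      Nat.cast_ne_zero.2 (Set.ncard_ne_zero_of_mem (mem_realConjClass_self h') (Set.toFinite _))
    have := congrFun e h
    simp [f, h1, h2] at this
    exact h3 (by exact_mod_cast this)
  · rw [matchingForm_apply]
    have h1 : ∀ P : PrimePowerSubgroup H, f ∘ (Subtype.val : P.1 → H) = 0 := by
      rintro ⟨P, p, k, hp, hk⟩
      funext y
      obtain ⟨j, -, hj⟩ := (Nat.dvd_prime_pow hp).1 ((orderOf_dvd_natCard y).trans hk.dvd)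
      exact hfv y ⟨p, j, hp, by rw [Subgroup.orderOf_coe, hj]⟩
    simp only [h1, map_zero, LinearMap.zero_apply, Finset.sum_const_zero, add_zero]
    let F : H → ℝ := charHom G (indRO H x) ∘ Subtype.val
    have hFG := charHom_mem (indRO H x)
    have hF : F ∈ realClassFunctions H :=
      ⟨fun g k => hFG.1 g k, fun g => hFG.2 g⟩
    -- Fusion enters here: `F` is restricted from `G`, so it cannot separate `h` from `h'`.
    have hFF : F h' = F h := apply_eq_of_mem_realConjClass hFG hG
    change classInner H f F = 0
    rw [classInner_comm, map_sub, map_smul, map_smul,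
      classInner_indicator (fun y hy => apply_eq_of_mem_realConjClass hF hy),
      classInner_indicator (fun y hy => apply_eq_of_mem_realConjClass hF hy), hFF,
      smul_eq_mul, smul_eq_mul]
    ring

end Main

end RealRepRing

end

theorem mainTheorem4 {G : Type u} [Group G] [Finite G] (H : Subgroup G) :
    ∃ hInd : ∀ x : RealRepRing.PO H,
        ((RealRepRing.indRO H).comp (RealRepRing.PO H).subtype) x ∈ RealRepRing.PO G,
      (Function.Injective
          (((RealRepRing.indRO H).comp (RealRepRing.PO H).subtype).codRestrict
            (RealRepRing.PO G) hInd) ↔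
        ∀ h : H, ¬ RealRepRing.HasPrimePowerOrder h →
          RealRepRing.realConjClass (h : G) ∩ (H : Set G) =
            Subtype.val '' RealRepRing.realConjClass h) := by
  refine ⟨fun x => RealRepRing.indRO_mem_PO H x.2, ?_⟩
  rw [injective_iff_map_eq_zero]
  constructor
  · intro hinj h hh
    refine Set.Subset.antisymm ?_ (RealRepRing.image_realConjClass_subset H h)
    rintro y ⟨hy, hyH⟩
    by_contra hn
    obtain ⟨x, hx, hx0, hind⟩ := RealRepRing.exists_ne_zero_mem_PO_of_fusion H (h' := ⟨y, hyH⟩)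
      hh hy fun hm => hn ⟨_, hm, rfl⟩
    exact hx0 (congrArg Subtype.val (hinj ⟨x, hx⟩ (Subtype.ext hind)))
  · intro hH x hx
    exact Subtype.ext (RealRepRing.eq_zero_of_indRO_eq_zero H hH x.2 (congrArg Subtype.val hx))
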